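/- Let $(X,\omega)$ be a connected Kähler manifold (not necessarily compact), and let $E$ be a smooth complex vector bundle of finite rank over $X$. Let $D$ be a smooth connection on $E$ that is non-Hermitian Yang-Mills (NHYM), i.e. its curvature satisfies $F_D=D^2\in\Omega^{1,1}_X(\mathrm{End}(E))$ and $\sqrt{-1}\Lambda_\omega F_D=\lambda\,\mathrm{Id}_E$ for a constant $\lambda\in\mathbb{R}$. Assume that $(E,D)$ is simple: $E\neq 0$, and the only $D$-invariant smooth complex subbundles of $E$ are $0$ and $E$. Let $\mathrm{End}(E,D)$ be the algebra of $D$-parallel endomorphisms of $E$, that is, of smooth complex bundle endomorphisms $f:E\to E$ with $D(f\sigma)=f(D\sigma)$ for every smooth section $\sigma$ of $E$. Then every $f\in\mathrm{End}(E,D)$ is of the form $f=c\,\mathrm{Id}_E$ with $c\in\mathbb{C}$, and $\mathrm{End}(E,D)\cong\mathbb{C}$ as complex algebras. -/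

import Mathlib

open Bundle Set
open scoped Manifold ContDiff Topology

noncomputable section KahlerBundles

/-! ## Complex manifolds and complex vector bundles as real smooth objects -/

section RealStructure

variable {M : Type*} [NormedAddCommGroup M] [NormedSpace ℂ M]
  {X : Type*} [TopologicalSpace X] [ChartedSpace M X]

/-- A complex manifold is a real (analytic, hence smooth) manifold. -/
instance isManifold_real_of_complex [IsManifold 𝓘(ℂ, M) ω X] : IsManifold 𝓘(ℝ, M) ω X := by
  apply isManifold_of_contDiffOn
  intro e e' he he'
  have h := (contDiffGroupoid ω 𝓘(ℂ, M)).compatible he he'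
  rw [contDiffGroupoid, mem_groupoid_of_pregroupoid, contDiffPregroupoid] at h
  exact h.1.restrict_scalars ℝ

/-- A complex vector bundle is in particular a real vector bundle. -/
instance vectorBundle_real_of_complex {F : Type*} [NormedAddCommGroup F] [NormedSpace ℂ F]
    {V : X → Type*} [TopologicalSpace (TotalSpace F V)] [∀ x, TopologicalSpace (V x)]
    [∀ x, AddCommGroup (V x)] [∀ x, Module ℂ (V x)] [FiberBundle F V] [VectorBundle ℂ F V] :
    VectorBundle ℝ F V where
  trivialization_linear' e _ := by
    constructor
    intro b hb
    have h := (Trivialization.linear ℂ e hb)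
    refine ⟨h.map_add, fun c v => ?_⟩
    have h2 := h.map_smul (c : ℂ) v
    simpa using h2
  continuousOn_coordChange' e e' _ _ := by
    have hlin : ∀ (e : Trivialization F (π F V)) [MemTrivializationAtlas e], e.IsLinear ℝ := by
      intro e _
      constructor
      intro b hb
      have h := (Trivialization.linear ℂ e hb)
      refine ⟨h.map_add, fun c v => ?_⟩
      have h2 := h.map_smul (c : ℂ) v
      simpa using h2
    have := hlin e
    have := hlin e'
    have h := (ContinuousLinearMap.restrictScalarsL ℂ F F ℝ ℝ).continuous.comp_continuousOn
      (continuousOn_coordChange (R := ℂ) e e')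
    refine h.congr fun b hb => ?_
    ext v
    simp [Trivialization.coordChangeL_apply _ _ hb]

/-- Real scalar multiplication is continuous on a complex topological vector space. -/
instance continuousSMul_real_of_complex {W : Type*} [AddCommGroup W] [Module ℂ W]
    [TopologicalSpace W] [ContinuousSMul ℂ W] : ContinuousSMul ℝ W :=
  IsScalarTower.continuousSMul ℂ

end RealStructure

variable {M : Type*} [NormedAddCommGroup M] [NormedSpace ℂ M]
  {X : Type*} [TopologicalSpace X] [ChartedSpace M X]

section Kahler

variable (M) in
/-- The almost complex structure `J` of a complex manifold. The tangent space at `x` is identified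
with the model space `M` through the preferred chart at `x`, and `J` is multiplication by `i`
there. As changes of charts are holomorphic, any other chart gives the same `J`. -/
def complexJ (x : X) : TangentSpace 𝓘(ℝ, M) x →L[ℝ] TangentSpace 𝓘(ℝ, M) x :=
  (Complex.I • ContinuousLinearMap.id ℝ M : M →L[ℝ] M)

/-- Smooth (real) vector fields. -/
def IsSmoothVectorField [IsManifold 𝓘(ℂ, M) ω X] (Y : Π x : X, TangentSpace 𝓘(ℝ, M) x) : Prop :=
  ContMDiff 𝓘(ℝ, M) (𝓘(ℝ, M).prod 𝓘(ℝ, M)) ∞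
    (fun x => TotalSpace.mk' M (E := fun x : X => TangentSpace 𝓘(ℝ, M) x) x (Y x))

/-- The fundamental form `(u, v) ↦ g (J u, v)` of a Riemannian metric `g`, pulled back to the model
space by the inverse of the chart at `x₀`, and evaluated on constant vector fields `u`, `v`. -/
def fundamentalFormInChart [IsManifold 𝓘(ℂ, M) ω X]
    (g : ContMDiffRiemannianMetric 𝓘(ℝ, M) ∞ M (fun x : X => TangentSpace 𝓘(ℝ, M) x))
    (x₀ : X) (u v : M) (z : M) : ℝ :=
  g.inner ((chartAt M x₀).symm z)
    (complexJ M _ (mfderiv 𝓘(ℝ, M) 𝓘(ℝ, M) (chartAt M x₀).symm z u))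
    (mfderiv 𝓘(ℝ, M) 𝓘(ℝ, M) (chartAt M x₀).symm z v)

variable (M X) in
/-- A Kähler metric on a complex manifold: a smooth Riemannian metric `g` which is invariant
under `J` and whose fundamental form `(u, v) ↦ g (J u, v)` is closed. -/
structure KahlerMetric [IsManifold 𝓘(ℂ, M) ω X] extends
    ContMDiffRiemannianMetric 𝓘(ℝ, M) ∞ M (fun x : X => TangentSpace 𝓘(ℝ, M) x) where
  inner_J (x : X) (u v : TangentSpace 𝓘(ℝ, M) x) :
    inner x (complexJ M x u) (complexJ M x v) = inner x u v
  /-- In each chart the exterior derivative of the fundamental form, evaluated on constant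
  vector fields `u`, `v`, `w`, vanishes. -/
  closed (x₀ : X) (y : M) (hy : y ∈ (chartAt M x₀).target) (u v w : M) :
    fderiv ℝ (fundamentalFormInChart toContMDiffRiemannianMetric x₀ v w) y u
      + fderiv ℝ (fundamentalFormInChart toContMDiffRiemannianMetric x₀ w u) y v
      + fderiv ℝ (fundamentalFormInChart toContMDiffRiemannianMetric x₀ u v) y w = 0

end Kahler

section Bundle

variable {F : Type*} [NormedAddCommGroup F] [NormedSpace ℂ F]
  {V : X → Type*} [TopologicalSpace (TotalSpace F V)] [∀ x, TopologicalSpace (V x)]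
  [∀ x, AddCommGroup (V x)] [∀ x, Module ℂ (V x)]
  [∀ x, IsTopologicalAddGroup (V x)] [∀ x, ContinuousSMul ℂ (V x)]
  [FiberBundle F V]

variable (M F) in
/-- Sections of a complex vector bundle that are smooth on a set `U`, in the real sense. -/
def IsSmoothSectionOn (σ : Π x : X, V x) (U : Set X) : Prop :=
  ContMDiffOn 𝓘(ℝ, M) (𝓘(ℝ, M).prod 𝓘(ℝ, F)) ∞ (fun x => TotalSpace.mk' F x (σ x)) U

variable (M F) in
/-- Global smooth sections of a complex vector bundle. -/
def IsSmoothSection (σ : Π x : X, V x) : Prop :=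
  ContMDiff 𝓘(ℝ, M) (𝓘(ℝ, M).prod 𝓘(ℝ, F)) ∞ (fun x => TotalSpace.mk' F x (σ x))

/-- Smooth connections on a complex vector bundle: `D` is a covariant derivative along real
tangent vectors, it is complex linear in the section, and it maps smooth sections to smooth
one-forms with values in the bundle. -/
structure IsSmoothComplexConnection [IsManifold 𝓘(ℂ, M) ω X] [VectorBundle ℂ F V]
    (D : CovariantDerivative 𝓘(ℝ, M) F V) : Prop where
  map_smul (c : ℂ) (σ : Π x : X, V x) (hσ : IsSmoothSection M F σ) (x : X)
    (u : TangentSpace 𝓘(ℝ, M) x) : D (c • σ) x u = c • D σ x u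
  smooth : D.ContMDiffCovariantDerivative ∞

/-- The curvature `F_D (Y, Z) σ = D_Y D_Z σ - D_Z D_Y σ - D_[Y, Z] σ`. -/
def curvature (D : CovariantDerivative 𝓘(ℝ, M) F V) (Y Z : Π x : X, TangentSpace 𝓘(ℝ, M) x)
    (σ : Π x : X, V x) (x : X) : V x :=
  D (fun y => D σ y (Z y)) x (Y x) - D (fun y => D σ y (Y y)) x (Z x)
    - D σ x (VectorField.mlieBracket 𝓘(ℝ, M) Y Z x)

/-- Non-Hermitian Yang-Mills connections on a complex vector bundle over a Kähler manifold. -/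
structure IsNHYM [IsManifold 𝓘(ℂ, M) ω X] [VectorBundle ℂ F V] (g : KahlerMetric M X)
    (D : CovariantDerivative 𝓘(ℝ, M) F V) : Prop where
  connection : IsSmoothComplexConnection D
  /-- The curvature is of type `(1,1)`, that is, `F_D (J Y, J Z) = F_D (Y, Z)`. -/
  type_one_one (Y Z : Π x : X, TangentSpace 𝓘(ℝ, M) x) (hY : IsSmoothVectorField Y)
    (hZ : IsSmoothVectorField Z) (σ : Π x : X, V x) (hσ : IsSmoothSection M F σ) (x : X) :
    curvature D (fun y => complexJ M y (Y y)) (fun y => complexJ M y (Z y)) σ x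
      = curvature D Y Z σ x
  /-- `√-1 Λ_ω F_D = λ Id` for a real constant `λ`. For vector fields `e₁, …, eₙ` such that
  `e₁, J e₁, …, eₙ, J eₙ` is an orthonormal basis at the point `x`, the contraction
  `Λ_ω F_D` at `x` with the fundamental form is `∑ⱼ F_D (eⱼ, J eⱼ)`. -/
  contraction : ∃ lam : ℝ, ∀ (x : X)
    (e : Fin (Module.finrank ℂ M) → Π y : X, TangentSpace 𝓘(ℝ, M) y),
    (∀ j, IsSmoothVectorField (e j)) →
    (∀ j k, g.inner x (e j x) (e k x) = if j = k then 1 else 0) →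
    (∀ j k, g.inner x (e j x) (complexJ M x (e k x)) = 0) →
    ∀ σ : Π y : X, V y, IsSmoothSection M F σ →
      Complex.I • ∑ j, curvature D (e j) (fun y => complexJ M y (e j y)) σ x = (lam : ℂ) • σ x

variable (M F) in
/-- Smooth complex subbundles: families of subspaces of the fibres that are spanned, near each
point, by a smooth local frame. -/
def IsSmoothSubbundle (S : Π x : X, Submodule ℂ (V x)) : Prop :=
  ∀ x₀ : X, ∃ U : Set X, IsOpen U ∧ x₀ ∈ U ∧ ∃ (k : ℕ) (s : Fin k → Π x : X, V x),
    (∀ i, IsSmoothSectionOn M F (s i) U) ∧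
    ∀ x ∈ U, LinearIndependent ℂ (fun i => s i x) ∧
      Submodule.span ℂ (range fun i => s i x) = S x

/-- `D`-subbundles: smooth subbundles `S` such that `D` maps sections of `S` to one-forms with
values in `S`. -/
structure IsDSubbundle (D : CovariantDerivative 𝓘(ℝ, M) F V)
    (S : Π x : X, Submodule ℂ (V x)) : Prop where
  subbundle : IsSmoothSubbundle M F S
  invariant (σ : Π x : X, V x) (hσ : IsSmoothSection M F σ) (hS : ∀ x, σ x ∈ S x) (x : X)
    (u : TangentSpace 𝓘(ℝ, M) x) : D σ x u ∈ S x

/-- `(E, D)` is simple if `E` is nonzero and has no `D`-subbundle besides `0` and `E`. -/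
structure IsSimpleBundle (D : CovariantDerivative 𝓘(ℝ, M) F V) : Prop where
  nonzero : (⊥ : Π x : X, Submodule ℂ (V x)) ≠ ⊤
  simple (S : Π x : X, Submodule ℂ (V x)) (hS : IsDSubbundle D S) : S = ⊥ ∨ S = ⊤

variable (M F) in
/-- Smooth bundle endomorphisms: families of complex linear maps of the fibres that are smooth
as a map of the total space. -/
def IsSmoothEndomorphism (f : Π x : X, Module.End ℂ (V x)) : Prop :=
  ContMDiff (𝓘(ℝ, M).prod 𝓘(ℝ, F)) (𝓘(ℝ, M).prod 𝓘(ℝ, F)) ∞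
    (fun p : TotalSpace F V => TotalSpace.mk' F p.1 (f p.1 p.2))

set_option linter.unusedSectionVars false in
/-- Sums of smooth bundle endomorphisms are smooth. -/
lemma IsSmoothEndomorphism.add_totalSpace [VectorBundle ℂ F V]
    {f h : Π x : X, Module.End ℂ (V x)} (hf : IsSmoothEndomorphism M F f)
    (hh : IsSmoothEndomorphism M F h) : IsSmoothEndomorphism M F (f + h) := by
  intro p
  have hf := contMDiffAt_totalSpace.1 (hf p)
  have hh := contMDiffAt_totalSpace.1 (hh p)
  refine contMDiffAt_totalSpace.2 ⟨hf.1, ?_⟩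
  refine (hf.2.add hh.2).congr_of_eventuallyEq ?_
  have hU : (π F V) ⁻¹' (trivializationAt F V p.1).baseSet ∈ 𝓝 p :=
    (FiberBundle.continuous_proj F V).continuousAt.preimage_mem_nhds
      ((trivializationAt F V p.1).open_baseSet.mem_nhds
        (FiberBundle.mem_baseSet_trivializationAt F V p.1))
  filter_upwards [hU] with q hq
  exact (Trivialization.linear ℂ (trivializationAt F V p.1) hq).map_add _ _

set_option linter.unusedSectionVars false in
/-- Scalar multiples of the identity are smooth bundle endomorphisms. -/
lemma isSmoothEndomorphism_algebraMap [VectorBundle ℂ F V] (c : ℂ) :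
    IsSmoothEndomorphism M F (algebraMap ℂ (Π x : X, Module.End ℂ (V x)) c) := by
  intro p
  have hp := contMDiffAt_totalSpace.1
    (contMDiffAt_id (I := 𝓘(ℝ, M).prod 𝓘(ℝ, F)) (n := ∞) (x := p))
  refine contMDiffAt_totalSpace.2 ⟨hp.1, ?_⟩
  have hc : ContMDiff 𝓘(ℝ, F) 𝓘(ℝ, F) ∞ (fun v : F => c • v) :=
    ((c • ContinuousLinearMap.id ℝ F : F →L[ℝ] F)).contMDiff
  refine (hc.contMDiffAt.comp p hp.2).congr_of_eventuallyEq ?_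
  have hU : (π F V) ⁻¹' (trivializationAt F V p.1).baseSet ∈ 𝓝 p :=
    (FiberBundle.continuous_proj F V).continuousAt.preimage_mem_nhds
      ((trivializationAt F V p.1).open_baseSet.mem_nhds
        (FiberBundle.mem_baseSet_trivializationAt F V p.1))
  filter_upwards [hU] with q hq
  exact (Trivialization.linear ℂ (trivializationAt F V p.1) hq).map_smul c _

/-- The algebra `End(E, D)` of `D`-parallel endomorphisms: smooth bundle endomorphisms `f` with
`D (f σ) = f (D σ)` for all smooth sections `σ`. -/
def parallelEnd [IsManifold 𝓘(ℂ, M) ω X] [VectorBundle ℂ F V]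
    (D : CovariantDerivative 𝓘(ℝ, M) F V) (hD : IsSmoothComplexConnection D) :
    Subalgebra ℂ (Π x : X, Module.End ℂ (V x)) where
  carrier := {f | IsSmoothEndomorphism M F f ∧ ∀ σ : Π x : X, V x, IsSmoothSection M F σ →
    ∀ (x : X) (u : TangentSpace 𝓘(ℝ, M) x), D (fun y => f y (σ y)) x u = f x (D σ x u)}
  mul_mem' := by
    rintro f h ⟨hf, hf'⟩ ⟨hh, hh'⟩
    refine ⟨hf.comp hh, fun σ hσ x u => ?_⟩
    have h1 : IsSmoothSection M F (fun y => h y (σ y)) := hh.comp hσ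
    exact (hf' _ h1 x u).trans (congrArg (f x) (hh' σ hσ x u))
  add_mem' := by
    rintro f h ⟨hf, hf'⟩ ⟨hh, hh'⟩
    refine ⟨IsSmoothEndomorphism.add_totalSpace hf hh, fun σ hσ x u => ?_⟩
    have h1 : IsSmoothSection M F (fun y => f y (σ y)) := hf.comp hσ
    have h2 : IsSmoothSection M F (fun y => h y (σ y)) := hh.comp hσ
    have h3 := D.isCovariantDerivativeOnUniv.add ((h1 x).mdifferentiableAt (by simp))
      ((h2 x).mdifferentiableAt (by simp))
    change D ((fun y => f y (σ y)) + (fun y => h y (σ y))) x u = f x (D σ x u) + h x (D σ x u)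
    rw [h3, ← hf' σ hσ, ← hh' σ hσ]
    rfl
  algebraMap_mem' := by
    intro c
    refine ⟨isSmoothEndomorphism_algebraMap c, fun σ hσ x u => hD.map_smul c σ hσ x u⟩

end Bundle

end KahlerBundles

/-! This is Schur's lemma. At a point `x₀` with nonzero fibre, a parallel `f` has a complex
eigenvalue `c`. Then `f - c` is parallel and its kernel is nonzero at `x₀`. If that kernel is a
`D`-subbundle, simplicity makes it all of `E`, so `f = c`. Invariance is immediate from `D (f σ) = f
(D σ)`. The real content is that the kernel of a parallel endomorphism has smooth local frames
(`isSmoothSubbundle_ker`).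

In a trivialization, parallelism reads `dK = K A - A K` for the connection form `A`
(`exists_connectionForm`). Instead of parallel transport, the proof deforms a generalized inverse:
if `K G K = K` at one point and `dG = -G dK G`, then `K - K G K` solves a homogeneous linear
equation along each segment, hence vanishes nearby by Grönwall
(`exists_smooth_generalized_inverse`). So `1 - G K` is a smooth family of projections onto the
kernels, and it carries a basis of one kernel to a frame of the neighbouring ones
(`eventually_span_projection_eq_ker`). -/

/-! ### Generalized inverses and kernels for solutions of `dK = K A - A K`. -/

section ParallelKernel

variable {R : Type*} [NormedRing R] [NormedAlgebra ℝ R]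

/-- If `k' = k a - a k` and `g' = - g k' g`, then `k - k g k` solves a linear equation. -/
lemma hasDerivAt_sub_generalized_inverse {k g : ℝ → R} {a : R} {t : ℝ}
    (hk : HasDerivAt k (k t * a - a * k t) t)
    (hg : HasDerivAt g (-(g t * (k t * a - a * k t) * g t)) t) :
    HasDerivAt (fun s => k s - k s * g s * k s)
      ((k t - k t * g t * k t) * a * (1 - g t * k t)
        - (1 - k t * g t) * a * (k t - k t * g t * k t)) t := by
  -- With `s = k - k g k`, the derivative is `(1 - k g) k' (1 - g k)`; inserting `k' = k a - a k`
  -- and `(1 - k g) k = s = k (1 - g k)` makes it linear in `s`.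
  refine (hk.sub ((hk.mul hg).mul hk)).congr_deriv ?_
  simp only [Pi.mul_apply]
  noncomm_ring

/-- Grönwall's inequality for the linear equation satisfied by `k - k g k`. -/
lemma mul_generalized_inverse_mul_eq_self {k g a : ℝ → R} {C C' : ℝ}
    (hk : ∀ t ∈ Icc (0 : ℝ) 1, HasDerivAt k (k t * a t - a t * k t) t)
    (hg : ∀ t ∈ Icc (0 : ℝ) 1, HasDerivAt g (-(g t * (k t * a t - a t * k t) * g t)) t)
    (ha : ∀ t ∈ Icc (0 : ℝ) 1, ‖a t‖ ≤ C) (hp : ∀ t ∈ Icc (0 : ℝ) 1, ‖1 - g t * k t‖ ≤ C')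
    (hq : ∀ t ∈ Icc (0 : ℝ) 1, ‖1 - k t * g t‖ ≤ C')
    (h0 : k 0 * g 0 * k 0 = k 0) : k 1 * g 1 * k 1 = k 1 := by
  have key := eq_zero_of_abs_deriv_le_mul_abs_self_of_eq_zero_right (a := (0 : ℝ)) (b := 1)
    (K := 2 * (C * C')) (f := fun s => k s - k s * g s * k s)
    (fun t ht => (hasDerivAt_sub_generalized_inverse (hk t ht) (hg t
      ht)).continuousAt.continuousWithinAt)
    (fun t ht => (hasDerivAt_sub_generalized_inverse (hk t (Ico_subset_Icc_self ht))
      (hg t (Ico_subset_Icc_self ht))).hasDerivWithinAt) (by simp [h0]) (fun t ht => ?_) 1 (by simp)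
  · exact (sub_eq_zero.1 key).symm
  · have ht' := Ico_subset_Icc_self ht
    have hC : 0 ≤ C := (norm_nonneg _).trans (ha t ht')
    set s := k t - k t * g t * k t
    have e1 : ‖s * a t * (1 - g t * k t)‖ ≤ ‖s‖ * C * C' :=
      (norm_mul_le _ _).trans (mul_le_mul ((norm_mul_le _ _).trans
        (mul_le_mul_of_nonneg_left (ha t ht') (norm_nonneg _))) (hp t ht') (norm_nonneg _)
        (by positivity))
    have e2 : ‖(1 - k t * g t) * a t * s‖ ≤ C' * C * ‖s‖ :=
      (norm_mul_le _ _).trans (mul_le_mul_of_nonneg_right ((norm_mul_le _ _).trans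
        (mul_le_mul (hq t ht') (ha t ht') (norm_nonneg _)
          ((norm_nonneg _).trans (hq t ht')))) (norm_nonneg _))
    calc _ ≤ ‖s * a t * (1 - g t * k t)‖ + ‖(1 - k t * g t) * a t * s‖ := norm_sub_le _ _
      _ ≤ 2 * (C * C') * ‖s‖ := by linarith

variable [CompleteSpace R] {E : Type*} [NormedAddCommGroup E] [NormedSpace ℝ E]

/-- A solution `K` of `dK = K A - A K` which is regular at `y₀` has a smooth family of generalized
inverses near `y₀`. -/
lemma exists_smooth_generalized_inverse {K : E → R} {A : E → E → R} {Ω : Set E} {y₀ : E} {C : ℝ}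
    (hΩ : IsOpen Ω) (hy₀ : y₀ ∈ Ω) (hK : ContDiffOn ℝ ∞ K Ω)
    (hA : ∀ y ∈ Ω, ∀ w, ‖A y w‖ ≤ C * ‖w‖)
    (hKA : ∀ y ∈ Ω, ∀ w, fderiv ℝ K y w = K y * A y w - A y w * K y)
    {g₀ : R} (h1 : K y₀ * g₀ * K y₀ = K y₀) :
    ∃ (G : E → R) (N : Set E), IsOpen N ∧ y₀ ∈ N ∧ N ⊆ Ω ∧ ContDiffOn ℝ ∞ G N ∧
      ∀ y ∈ N, K y * G y * K y = K y := by
  -- `G = g₀ U⁻¹` is the solution of `dG = -G dK G` with value `g₀` at `y₀`: the derivative of `U`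
  -- is `dK g₀`, so that of `g₀ U⁻¹` is `-g₀ U⁻¹ dK g₀ U⁻¹`.
  let U : E → R := fun y => 1 + (K y - K y₀) * g₀
  let G : E → R := fun y => g₀ * Ring.inverse (U y)
  have hU : ContDiffOn ℝ ∞ U Ω := contDiffOn_const.add ((hK.sub contDiffOn_const).mul
    contDiffOn_const)
  have hU₀ : U y₀ = 1 := by simp [U]
  have hG₀ : G y₀ = g₀ := by simp [G, hU₀]
  obtain ⟨r₁, hr₁, hN₁⟩ : ∃ r > 0, ∀ y ∈ Metric.ball y₀ r, y ∈ Ω ∧ IsUnit (U y) := by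
    refine Metric.eventually_nhds_iff_ball.1 (Filter.Eventually.and (hΩ.mem_nhds hy₀) ?_)
    have hc : ContinuousAt U y₀ := hU.continuousOn.continuousAt (hΩ.mem_nhds hy₀)
    exact hc.eventually (Units.isOpen.mem_nhds (by rw [hU₀]; exact isUnit_one))
  have hKd : ∀ y ∈ Ω, HasFDerivAt K (fderiv ℝ K y) y := fun y hy =>
    ((hK.contDiffAt (hΩ.mem_nhds hy)).differentiableAt (by simp)).hasFDerivAt
  have hGs : ContDiffOn ℝ ∞ G (Metric.ball y₀ r₁) := by
    intro y hy
    obtain ⟨hyΩ, u, hu⟩ := hN₁ y hy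
    refine (contDiffAt_const.mul (ContDiffAt.comp (g := Ring.inverse) y ?_
      (hU.contDiffAt (hΩ.mem_nhds hyΩ)))).contDiffWithinAt
    rw [← hu]
    exact contDiffAt_ringInverse ℝ u
  have hGd : ∀ y ∈ Metric.ball y₀ r₁, ∀ γ : ℝ → E, ∀ t w, γ t = y → HasDerivAt γ w t →
      HasDerivAt (fun s => G (γ s)) (-(G y * (fderiv ℝ K y w) * G y)) t := by
    rintro y hy γ t w rfl hγ
    obtain ⟨hyΩ, u, hu⟩ := hN₁ _ hy
    have d1 : HasDerivAt (fun s => U (γ s)) (fderiv ℝ K (γ t) w * g₀) t :=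
      (((hKd _ hyΩ).comp_hasDerivAt t hγ).sub_const _ |>.mul_const _).const_add _
    have d2 : HasFDerivAt Ring.inverse _ (U (γ t)) := hu ▸ hasFDerivAt_ringInverse (𝕜 := ℝ) u
    refine ((d2.comp_hasDerivAt t d1).const_mul g₀).congr_deriv ?_
    have : G (γ t) = g₀ * ↑u⁻¹ := by simp [G, ← hu]
    rw [this]
    simp only [neg_apply, ContinuousLinearMap.mulLeftRight_apply]
    noncomm_ring
  -- One constant above both norms at `y₀`, to serve as `C'` in the Grönwall estimate.
  have hbd : ∀ᶠ y in 𝓝 y₀, ‖1 - G y * K y‖ < ‖1 - G y₀ * K y₀‖ + ‖1 - K y₀ * G y₀‖ + 1 ∧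
      ‖1 - K y * G y‖ < ‖1 - G y₀ * K y₀‖ + ‖1 - K y₀ * G y₀‖ + 1 := by
    have cG : ContinuousAt G y₀ := hGs.continuousOn.continuousAt (Metric.ball_mem_nhds _ hr₁)
    have cK : ContinuousAt K y₀ := hK.continuousOn.continuousAt (hΩ.mem_nhds hy₀)
    refine ((continuousAt_const.sub (cG.mul cK)).norm.eventually (gt_mem_nhds ?_)).and
      ((continuousAt_const.sub (cK.mul cG)).norm.eventually (gt_mem_nhds ?_))
    · change ‖1 - G y₀ * K y₀‖ < _
      linarith [norm_nonneg (1 - K y₀ * G y₀)]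
    · change ‖1 - K y₀ * G y₀‖ < _
      linarith [norm_nonneg (1 - G y₀ * K y₀)]
  obtain ⟨r₂, hr₂, hN₂⟩ := Metric.eventually_nhds_iff_ball.1
    (hbd.and (Metric.ball_mem_nhds y₀ hr₁))
  refine ⟨G, Metric.ball y₀ r₂, Metric.isOpen_ball, Metric.mem_ball_self hr₂,
    fun y hy => (hN₁ y (hN₂ y hy).2).1, hGs.mono fun y hy => (hN₂ y hy).2, fun y hy => ?_⟩
  -- The ball is convex, so Grönwall applies along the segment from `y₀` to `y`. Only a bound on `A`
  -- enters, neither its continuity nor its linearity.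
  let γ : ℝ → E := fun t => y₀ + t • (y - y₀)
  have hγ : ∀ t ∈ Icc (0 : ℝ) 1, γ t ∈ Metric.ball y₀ r₂ := fun t ht =>
    (convex_ball y₀ r₂).add_smul_sub_mem (Metric.mem_ball_self hr₂) hy ht
  have hγd : ∀ t, HasDerivAt γ (y - y₀) t := fun t => by
    simpa [γ] using! ((hasDerivAt_id t).smul_const (y - y₀)).const_add y₀
  have hγ₁ : γ 1 = y := by simp [γ]
  have hγ₀ : γ 0 = y₀ := by simp [γ]
  have := mul_generalized_inverse_mul_eq_self (k := fun t => K (γ t)) (g := fun t => G (γ t))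
    (a := fun t => A (γ t) (y - y₀)) (C := C * ‖y - y₀‖)
    (fun t ht => ?_) (fun t ht => ?_) (fun t ht => ?_) (fun t ht => (hN₂ _ (hγ t ht)).1.1.le)
    (fun t ht => (hN₂ _ (hγ t ht)).1.2.le) (by simp only [hγ₀, hG₀, h1])
  · simpa only [hγ₁] using this
  · have hm := (hN₁ _ (hN₂ _ (hγ t ht)).2).1
    rw [← hKA _ hm]
    exact (hKd _ hm).comp_hasDerivAt t (hγd t)
  · have hm := (hN₂ _ (hγ t ht)).2
    rw [← hKA _ (hN₁ _ hm).1]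
    exact hGd _ hm γ t _ rfl (hγd t)
  · exact hA _ (hN₁ _ (hN₂ _ (hγ t ht)).2).1 _

/-- Generalized inverses of linear endomorphisms. -/
lemma LinearMap.exists_generalized_inverse {𝕜 W : Type*} [Field 𝕜] [AddCommGroup W] [Module 𝕜 W]
    (k : Module.End 𝕜 W) : ∃ g : Module.End 𝕜 W, k * g * k = k := by
  obtain ⟨Q, hQ⟩ := Submodule.exists_isCompl (LinearMap.ker k)
  -- `k` is injective on a complement `Q` of its kernel; a left inverse of `k` on `Q` is the
  -- generalized inverse.
  obtain ⟨g, hg⟩ := LinearMap.exists_leftInverse_of_injective (k ∘ₗ Q.subtype) (by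
    rw [LinearMap.ker_eq_bot']
    rintro ⟨m, hm⟩ h
    have : m ∈ LinearMap.ker k ⊓ Q := ⟨h, hm⟩
    rw [hQ.inf_eq_bot] at this
    simpa using this)
  have hg' : ∀ q : Q, g (k q) = q := fun q => LinearMap.congr_fun hg q
  refine ⟨Q.subtype ∘ₗ g, LinearMap.ext fun x => ?_⟩
  obtain ⟨a, ha, b, hb, rfl⟩ := Submodule.mem_sup.1 (hQ.sup_eq_top ▸ Submodule.mem_top (x := x))
  have ha : k a = 0 := ha
  have := hg' ⟨b, hb⟩
  simp only [Module.End.mul_apply, map_add, ha, zero_add, LinearMap.comp_apply, this,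
    Submodule.subtype_apply, map_zero]

variable {F : Type*} [NormedAddCommGroup F] [NormedSpace ℂ F] [FiniteDimensional ℂ F]

/-- The kernels of a family of complex linear maps that are the ranges of a continuous family
of real projections have a local frame. -/
lemma eventually_span_projection_eq_ker {Y : Type*} [TopologicalSpace Y]
    {L : Y → F →ₗ[ℂ] F} {P : Y → F →L[ℝ] F} {y₀ : Y} (hP : ContinuousAt P y₀)
    (h1 : ∀ᶠ y in 𝓝 y₀, ∀ w, L y (P y w) = 0)
    (h2 : ∀ᶠ y in 𝓝 y₀, ∀ w, L y w = 0 → P y w = w) :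
    ∃ (k : ℕ) (v : Fin k → F), ∀ᶠ y in 𝓝 y₀, LinearIndependent ℂ (fun i => P y (v i)) ∧
      Submodule.span ℂ (range fun i => P y (v i)) = LinearMap.ker (L y) := by
  have : FiniteDimensional ℝ F := FiniteDimensional.complexToReal F
  let b := Module.finBasis ℂ (LinearMap.ker (L y₀))
  refine ⟨_, fun i => (b i : F), ?_⟩
  have e1 : ∀ᶠ y in 𝓝 y₀, LinearIndependent ℂ (fun i => P y (b i : F)) := by
    have hb : LinearIndependent ℂ (fun i => P y₀ (b i : F)) := by
      have : (fun i => P y₀ (b i : F)) = fun i => (b i : F) :=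
        funext fun i => h2.self_of_nhds _ (b i).2
      rw [this]
      exact b.linearIndependent.map' (Submodule.subtype _) (Submodule.ker_subtype _)
    have hc : ContinuousAt (fun y i => P y (b i : F)) y₀ :=
      continuousAt_pi.2 fun i => hP.clm_apply continuousAt_const
    exact hc.eventually hb.eventually
  have e2 : ∀ᶠ y in 𝓝 y₀, ‖P y - P y₀‖ < 1 :=
    (hP.sub continuousAt_const).norm.eventually (gt_mem_nhds (by simp))
  filter_upwards [e1, e2, h1, h2] with y h1y h2y h3y h4y
  refine ⟨h1y, Submodule.eq_of_le_of_finrank_le ?_ ?_⟩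
  · rw [Submodule.span_le]
    rintro _ ⟨i, rfl⟩
    exact h3y _
  · rw [finrank_span_eq_card h1y, Fintype.card_fin]
    -- The kernel cannot grow near `y₀`: a vector `w` of `ker (L y)` killed by `P y₀` equals `(P y -
    -- P y₀) w`, which is shorter than `w` unless `w = 0`. As `P` is only real linear, this compares
    -- real dimensions, which are twice the complex ones.
    let T : LinearMap.ker (L y) →ₗ[ℝ] LinearMap.ker (L y₀) :=
      { toFun := fun w => ⟨P y₀ w, h1.self_of_nhds _⟩
        map_add' := fun _ _ => Subtype.ext (by simp)
        map_smul' := fun c w => Subtype.ext (by simp) }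
    have hT : Function.Injective T := by
      rw [← LinearMap.ker_eq_bot, LinearMap.ker_eq_bot']
      rintro ⟨w, hw⟩ h
      have h0 : P y₀ w = 0 := congrArg Subtype.val h
      have hw' : w = (P y - P y₀) w := by simp [h0, h4y w hw]
      have hn : ‖w‖ ≤ ‖P y - P y₀‖ * ‖w‖ := by
        conv_lhs => rw [hw']
        exact (P y - P y₀).le_opNorm w
      refine Subtype.ext (norm_eq_zero.1 ?_)
      change ‖w‖ = 0
      nlinarith [norm_nonneg w]
    have hr := LinearMap.finrank_le_finrank_of_injective hT
    rw [finrank_real_of_complex, finrank_real_of_complex] at hr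
    omega

end ParallelKernel

/-! ### Local sections and endomorphisms in a trivialization. -/

section ConnectionForm

/-- The Leibniz rule for finite sums. -/
lemma IsCovariantDerivativeOn.sum_smul {𝕜 E H N F : Type*} [NontriviallyNormedField 𝕜]
    [NormedAddCommGroup E] [NormedSpace 𝕜 E] [TopologicalSpace H] {I : ModelWithCorners 𝕜 E H}
    [TopologicalSpace N] [ChartedSpace H N] [NormedAddCommGroup F] [NormedSpace 𝕜 F]
    {V : N → Type*} [TopologicalSpace (TotalSpace F V)] [∀ x, AddCommGroup (V x)]
    [∀ x, Module 𝕜 (V x)] [∀ x, TopologicalSpace (V x)] [∀ x, IsTopologicalAddGroup (V x)]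
    [∀ x, ContinuousSMul 𝕜 (V x)] [FiberBundle F V] [VectorBundle 𝕜 F V]
    {D : (Π x : N, V x) → (Π x : N, TangentSpace I x →L[𝕜] V x)}
    (hD : IsCovariantDerivativeOn F D) {ι : Type*} (s : Finset ι) {g : ι → N → 𝕜}
    {σ : ι → Π x : N, V x} {x : N} (hg : ∀ i, MDiffAt (g i) x) (hσ : ∀ i, MDiffAt (T% (σ i)) x) :
    D (fun y => ∑ i ∈ s, g i y • σ i y) x
      = ∑ i ∈ s, (g i x • D (σ i) x + (mvfderiv I (g i) x).smulRight (σ i x)) := by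
  classical
  induction s using Finset.induction_on with
  | empty =>
    simp only [Finset.sum_empty]
    exact hD.zero
  | insert i s hi ih =>
    have h : (fun y => ∑ j ∈ insert i s, g j y • σ j y)
        = g i • σ i + fun y => ∑ j ∈ s, g j y • σ j y := by
      funext y
      simp [Finset.sum_insert hi]
    have hs : MDiffAt (T% (fun y => ∑ j ∈ s, g j y • σ j y)) x :=
      .sum_section (t := fun j y => g j y • σ j y) fun j _ => (hg j).smul_section (hσ j)
    rw [h, hD.add ((hg i).smul_section (hσ i)) hs, ih, hD.leibniz (hσ i) (hg i), Finset.sum_insert hi]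

variable {M : Type*} [NormedAddCommGroup M] [NormedSpace ℂ M]
  {X : Type*} [TopologicalSpace X] [ChartedSpace M X]
  {F : Type*} [NormedAddCommGroup F] [NormedSpace ℂ F]
  {V : X → Type*} [TopologicalSpace (TotalSpace F V)] [∀ x, TopologicalSpace (V x)]
  [∀ x, AddCommGroup (V x)] [∀ x, Module ℂ (V x)]
  [FiberBundle F V] [VectorBundle ℂ F V]

/-- The section which is constant in a trivialization is smooth. -/
lemma contMDiffOn_trivialization_symm [ContMDiffVectorBundle ∞ F V 𝓘(ℝ, M)]
    (e : Trivialization F (π F V)) [MemTrivializationAtlas e] {w : X → F} {U : Set X}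
    (hU : IsOpen U) (hUe : U ⊆ e.baseSet) (hw : ContMDiffOn 𝓘(ℝ, M) 𝓘(ℝ, F) ∞ w U) :
    IsSmoothSectionOn M F (fun x => e.symm x (w x)) U := by
  rw [IsSmoothSectionOn, e.contMDiffOn_section_iff hU hUe]
  exact hw.congr fun x hx => by rw [e.apply_mk_symm (hUe hx)]

/-- Constant sections in a trivialization extend to global smooth sections. -/
lemma exists_smoothSection_eventuallyEq [FiniteDimensional ℂ M]
    [∀ x, IsTopologicalAddGroup (V x)] [∀ x, ContinuousSMul ℂ (V x)] [IsManifold 𝓘(ℂ, M) ω X] [T2Space X]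
    [ContMDiffVectorBundle ∞ F V 𝓘(ℝ, M)] (e : Trivialization F (π F V))
    [MemTrivializationAtlas e] {x₀ : X} (hx₀ : x₀ ∈ e.baseSet) (v : F) :
    ∃ σ : Π x, V x, IsSmoothSection M F σ ∧ ∀ᶠ x in 𝓝 x₀, σ x = e.symm x v := by
  have : FiniteDimensional ℝ M := FiniteDimensional.complexToReal M
  have : IsManifold 𝓘(ℝ, M) ∞ X := IsManifold.of_le (n := ω) le_top
  -- Parallelism is tested on global sections only, so local constant sections are cut off by a bump
  -- function supported in the base set.
  obtain ⟨ψ, hψ, -⟩ := (SmoothBumpFunction.nhds_basis_support (I := 𝓘(ℝ, M))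
    (e.open_baseSet.mem_nhds hx₀)).mem_iff.1 (e.open_baseSet.mem_nhds hx₀)
  refine ⟨(ψ : X → ℝ) • fun x => e.symm x v, ?_, ?_⟩
  · exact ContMDiffOn.smul_section_of_tsupport ψ.contMDiff.contMDiffOn e.open_baseSet hψ
      (contMDiffOn_trivialization_symm e e.open_baseSet subset_rfl contMDiffOn_const)
  · filter_upwards [ψ.eventuallyEq_one] with x hx
    simp [hx]

/-- A family of endomorphisms of the fibres, read in a trivialization. -/
noncomputable def endInTrivialization (e : Trivialization F (π F V)) [MemTrivializationAtlas e]
    (f : Π x : X, Module.End ℂ (V x)) (x : X) : Module.End ℂ F :=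
  e.linearMapAt ℂ x ∘ₗ f x ∘ₗ e.symmₗ ℂ x

variable (e : Trivialization F (π F V)) [MemTrivializationAtlas e]

lemma endInTrivialization_apply (f : Π x : X, Module.End ℂ (V x)) {x : X} (hx : x ∈ e.baseSet)
    (v : F) : endInTrivialization e f x v = (e ⟨x, f x (e.symm x v)⟩).2 := by
  simp [endInTrivialization, e.symmₗ_apply hx, hx]

lemma symm_endInTrivialization (f : Π x : X, Module.End ℂ (V x)) {x : X} (hx : x ∈ e.baseSet)
    (v : F) : e.symm x (endInTrivialization e f x v) = f x (e.symm x v) := by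
  simp only [endInTrivialization, LinearMap.comp_apply, e.symm_linearMapAt hx, e.symmₗ_apply hx]

variable [FiniteDimensional ℂ F]

/-- A family of endomorphisms of the fibres, read in a trivialization as a family of continuous
real linear maps. -/
noncomputable def realEndInTrivialization (f : Π x : X, Module.End ℂ (V x)) (x : X) : F →L[ℝ] F :=
  (LinearMap.toContinuousLinearMap (endInTrivialization e f x)).restrictScalars ℝ

lemma realEndInTrivialization_apply (f : Π x : X, Module.End ℂ (V x)) (x : X) (v : F) :
    realEndInTrivialization e f x v = endInTrivialization e f x v := rfl

/-- Smoothness on the total space gives smoothness of `K x v` for each fixed `v`. As `F` is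
finite-dimensional, `K x` is recovered from its values on a basis by fixed continuous linear maps,
so it is smooth in operator norm. -/
lemma contMDiffOn_realEndInTrivialization [ContMDiffVectorBundle ∞ F V 𝓘(ℝ, M)]
    {f : Π x : X, Module.End ℂ (V x)} (hf : IsSmoothEndomorphism M F f) :
    ContMDiffOn 𝓘(ℝ, M) 𝓘(ℝ, F →L[ℝ] F) ∞ (realEndInTrivialization e f) e.baseSet := by
  have : FiniteDimensional ℝ F := FiniteDimensional.complexToReal F
  let b := Module.finBasis ℝ F
  have hv : ∀ v : F, ContMDiffOn 𝓘(ℝ, M) 𝓘(ℝ, F) ∞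
      (fun x => realEndInTrivialization e f x v) e.baseSet := by
    intro v
    have h := hf.comp_contMDiffOn
      (contMDiffOn_trivialization_symm (M := M) e e.open_baseSet subset_rfl
        (contMDiffOn_const (c := v)))
    refine ((e.contMDiffOn_section_baseSet_iff (s := fun x => f x (e.symm x v))).1 h).congr
      fun x hx => ?_
    rw [realEndInTrivialization_apply, endInTrivialization_apply e f hx]
  have hsum : realEndInTrivialization e f = fun x => ∑ i,
      ContinuousLinearMap.smulRightL ℝ F F (LinearMap.toContinuousLinearMap (b.coord i))
        (realEndInTrivialization e f x (b i)) := by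
    funext x
    ext v
    conv_lhs => rw [← b.sum_repr v, map_sum]
    simp
  rw [hsum]
  exact contMDiffOn_finsetSum fun i _ => ContMDiff.comp_contMDiffOn
    (ContinuousLinearMap.contMDiff _) (hv _)

end ConnectionForm

/-! ### The equation of a parallel endomorphism. -/

section ConnectionForm

variable {M : Type*} [NormedAddCommGroup M] [NormedSpace ℂ M]
  {X : Type*} [TopologicalSpace X] [ChartedSpace M X]
  {F : Type*} [NormedAddCommGroup F] [NormedSpace ℂ F] [FiniteDimensional ℂ F]
  {V : X → Type*} [TopologicalSpace (TotalSpace F V)] [∀ x, TopologicalSpace (V x)]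
  [∀ x, AddCommGroup (V x)] [∀ x, Module ℂ (V x)]
  [∀ x, IsTopologicalAddGroup (V x)] [∀ x, ContinuousSMul ℂ (V x)]
  [FiberBundle F V] [VectorBundle ℂ F V] [ContMDiffVectorBundle ∞ F V 𝓘(ℝ, M)]
  [FiniteDimensional ℂ M] [IsManifold 𝓘(ℂ, M) ω X] [T2Space X]

set_option maxHeartbeats 1000000 in
/-- A parallel endomorphism, read in a trivialization, solves `dK = K A - A K` for a locally
bounded one-form `A` with values in endomorphisms. -/
lemma exists_connectionForm {D : CovariantDerivative 𝓘(ℝ, M) F V}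
    (hD : D.ContMDiffCovariantDerivative ∞) (x₀ : X) {f : Π x : X, Module.End ℂ (V x)}
    (hf : IsSmoothEndomorphism M F f)
    (hfD : ∀ σ : Π x : X, V x, IsSmoothSection M F σ →
      ∀ (x : X) (u : TangentSpace 𝓘(ℝ, M) x), D (fun y => f y (σ y)) x u = f x (D σ x u)) :
    ∃ (A : X → M → F →L[ℝ] F) (C : ℝ), ∀ᶠ x in 𝓝 x₀, ∀ w : M, ‖A x w‖ ≤ C * ‖w‖ ∧
      mvfderiv 𝓘(ℝ, M) (realEndInTrivialization (trivializationAt F V x₀) f) x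
          ((trivializationAt M (TangentSpace 𝓘(ℝ, M) (M := X)) x₀).symmL ℝ x w)
        = realEndInTrivialization (trivializationAt F V x₀) f x * A x w
          - A x w * realEndInTrivialization (trivializationAt F V x₀) f x := by
  have : FiniteDimensional ℝ F := FiniteDimensional.complexToReal F
  set e := trivializationAt F V x₀
  set K := realEndInTrivialization e f with hK
  have hx₀ : x₀ ∈ e.baseSet := FiberBundle.mem_baseSet_trivializationAt F V x₀
  -- A real basis, because the Leibniz rule of `D` concerns real-valued coefficients.
  let b := Module.finBasis ℝ F
  choose σ hσ hσe using fun i => exists_smoothSection_eventuallyEq (M := M) e hx₀ (b i)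
  let a := fun (i) (x : X) => ContinuousLinearMap.inCoordinates M
    (TangentSpace 𝓘(ℝ, M) (M := X)) F V x₀ x x₀ x (D (σ i) x)
  have ha : ∀ i, ContinuousAt (a i) x₀ := fun i =>
    ((contMDiffAt_hom_bundle _).1 (hD.contMDiff.contMDiff (σ := σ i)
      (by simpa using (hσ i).contMDiffOn) |>.contMDiffAt Filter.univ_mem)).2.continuousAt
  let coordL := fun i => LinearMap.toContinuousLinearMap (b.coord i)
  -- The connection form of the frame `σ`: it sends `b i` to the coordinates of `D (σ i)` in
  -- direction `w`.
  let A := fun (x : X) (w : M) => ∑ i, (coordL i).smulRight (a i x w)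
  have hAb : ∀ x w i, A x w (b i) = a i x w := by
    intro x w i
    simp [A, coordL, Finsupp.single_apply, ite_smul]
  refine ⟨A, ∑ i, ‖coordL i‖ * (‖a i x₀‖ + 1), ?_⟩
  have hbd : ∀ᶠ x in 𝓝 x₀, ∀ i, ‖a i x‖ < ‖a i x₀‖ + 1 :=
    Filter.eventually_all.2 fun i => (ha i).norm.eventually (gt_mem_nhds (by simp))
  have hσ' : ∀ᶠ x in 𝓝 x₀, ∀ i, σ i x = e.symm x (b i) := Filter.eventually_all.2 hσe
  -- The sections must agree with the constant frame on a neighbourhood of `x`, since `D` will be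
  -- applied at `x`.
  filter_upwards [hbd, hσ'.eventually_nhds, e.open_baseSet.mem_nhds hx₀] with x hxa hxσ hxe w
  constructor
  · rw [Finset.sum_mul]
    refine norm_sum_le_of_le _ fun i _ => ?_
    rw [ContinuousLinearMap.norm_smulRight_apply, mul_assoc]
    gcongr
    exact ((a i x).le_opNorm w).trans (by gcongr; exact (hxa i).le)
  have hKx : MDifferentiableAt 𝓘(ℝ, M) 𝓘(ℝ, F →L[ℝ] F) K x :=
    ((contMDiffOn_realEndInTrivialization (M := M) e hf).contMDiffAt
    (e.open_baseSet.mem_nhds hxe)).mdifferentiableAt (by simp)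
  set u := (trivializationAt M (TangentSpace 𝓘(ℝ, M) (M := X)) x₀).symmL ℝ x w
  have hau : ∀ i, e.continuousLinearMapAt ℝ x (D (σ i) x u) = a i x w := fun i => rfl
  have hsd : ∀ i, MDifferentiableAt 𝓘(ℝ, M) (𝓘(ℝ, M).prod 𝓘(ℝ, F))
      (fun y => TotalSpace.mk' F y (σ i y)) x := fun i => (hσ i x).mdifferentiableAt (by simp)
  refine ContinuousLinearMap.coe_injective (b.ext fun j => ?_)
  -- Column `j` of the matrix of `K`. Expanding `D (f σⱼ)` by Leibniz gives `A K bⱼ + dK bⱼ`, while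
  -- parallelism gives `K A bⱼ`.
  let κ := fun (i) (y : X) => coordL i (K y (b j))
  let T := fun i => (coordL i).comp (ContinuousLinearMap.apply ℝ F (b j))
  have hκ : ∀ i, HasMFDerivAt 𝓘(ℝ, M) 𝓘(ℝ, ℝ) (κ i) x _ := fun i =>
    ((T i).hasMFDerivAt).comp x hKx.hasMFDerivAt
  have hfσ : ∀ᶠ y in 𝓝 x, f y (σ j y) = ∑ i, κ i y • σ i y := by
    filter_upwards [hxσ, e.open_baseSet.mem_nhds hxe] with y hy hye
    rw [hy j, ← symm_endInTrivialization e f hye, ← realEndInTrivialization_apply, ← hK]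
    conv_lhs => rw [← b.sum_repr (K y (b j)), ← e.symmₗ_apply (R := ℝ) hye, map_sum]
    refine Finset.sum_congr rfl fun i _ => ?_
    rw [map_smul, e.symmₗ_apply hye, hy i]
    rfl
  have hD1 : D (fun y => f y (σ j y)) x
      = ∑ i, (κ i x • D (σ i) x + (mvfderiv 𝓘(ℝ, M) (κ i) x).smulRight (σ i x)) := by
    rw [← D.isCovariantDerivativeOnUniv.sum_smul _ (fun i => (hκ i).mdifferentiableAt) hsd]
    exact D.isCovariantDerivativeOnUniv.congr_of_eventuallyEq
      (((hf.comp (hσ j)) x).mdifferentiableAt (by simp))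
      (.sum_section (t := fun i y => κ i y • σ i y) fun i _ =>
        ((hκ i).mdifferentiableAt).smul_section (hsd i)) Filter.univ_mem hfσ
  have hD2 : K x (a j x w) = ∑ i, (κ i x • a i x w + mvfderiv 𝓘(ℝ, M) (κ i) x u • b i) := by
    have h := congrArg (fun t => e.continuousLinearMapAt ℝ x (t u)) hD1
    have hs : ∀ i, e.continuousLinearMapAt ℝ x (σ i x) = b i := fun i => by
      rw [hxσ.self_of_nhds i, ← e.symmL_apply (R := ℝ) hxe, e.continuousLinearMapAt_symmL hxe]
    simp only [sum_apply, add_apply,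
      smul_apply, ContinuousLinearMap.smulRight_apply, map_sum, map_add,
      map_smul, hau, hs] at h
    rw [← h, hfD _ (hσ j), hK, realEndInTrivialization_apply, endInTrivialization_apply e f hxe,
      ← hau, ← e.symmL_apply (R := ℝ) hxe, e.symmL_continuousLinearMapAt hxe]
    simp [hxe]
  have hD3 : ∑ i, mvfderiv 𝓘(ℝ, M) (κ i) x u • b i = mvfderiv 𝓘(ℝ, M) K x u (b j) := by
    conv_rhs => rw [← b.sum_repr (mvfderiv 𝓘(ℝ, M) K x u (b j))]
    refine Finset.sum_congr rfl fun i _ => ?_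
    congr 1
    simp only [mvfderiv, (hκ i).mfderiv]
    rfl
  have hD4 : A x w (K x (b j)) = ∑ i, κ i x • a i x w := by
    simp [A, κ]
  change mvfderiv 𝓘(ℝ, M) K x u (b j) = K x (A x w (b j)) - A x w (K x (b j))
  rw [hAb, hD2, hD4, Finset.sum_add_distrib, hD3]
  abel

end ConnectionForm

/-! ### Kernels of parallel endomorphisms as `D`-subbundles. -/

section ParallelSubbundle

variable {M : Type*} [NormedAddCommGroup M] [NormedSpace ℂ M]
  {X : Type*} [TopologicalSpace X] [ChartedSpace M X]
  {F : Type*} [NormedAddCommGroup F] [NormedSpace ℂ F]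
  {V : X → Type*} [TopologicalSpace (TotalSpace F V)] [∀ x, TopologicalSpace (V x)]
  [∀ x, AddCommGroup (V x)] [∀ x, Module ℂ (V x)]
  [FiberBundle F V] [VectorBundle ℂ F V]

/-- A frame of the kernel in a trivialization gives a frame of the kernel. -/
lemma linearIndependent_and_span_symm_eq_ker (e : Trivialization F (π F V))
    [MemTrivializationAtlas e] (f : Π x : X, Module.End ℂ (V x)) {x : X} (hx : x ∈ e.baseSet)
    {ι : Type*} {w : ι → F} (hw : LinearIndependent ℂ w)
    (hs : Submodule.span ℂ (range w) = LinearMap.ker (endInTrivialization e f x)) :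
    LinearIndependent ℂ (fun i => e.symm x (w i)) ∧
      Submodule.span ℂ (range fun i => e.symm x (w i)) = LinearMap.ker (f x) := by
  let E := (e.linearEquivAt ℂ x hx).symm
  have hE : (fun i => e.symm x (w i)) = E ∘ w := rfl
  rw [hE]
  refine ⟨hw.map' E.toLinearMap E.ker, ?_⟩
  have hspan : Submodule.span ℂ (range (E ∘ w)) = (Submodule.span ℂ (range w)).map E.toLinearMap := by
    rw [range_comp, Submodule.map_span]
    rfl
  rw [hspan, hs]
  have hcomm : ∀ y, E (endInTrivialization e f x y) = f x (E y) := fun y =>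
    symm_endInTrivialization e f hx y
  ext v
  rw [Submodule.mem_map]
  constructor
  · rintro ⟨y, hy, rfl⟩
    change f x (E y) = 0
    rw [← hcomm, LinearMap.mem_ker.1 hy, map_zero]
  · intro hv
    refine ⟨E.symm v, E.injective ?_, E.apply_symm_apply v⟩
    rw [hcomm, E.apply_symm_apply, map_zero]
    exact hv

variable [∀ x, IsTopologicalAddGroup (V x)] [∀ x, ContinuousSMul ℂ (V x)]
  [ContMDiffVectorBundle ∞ F V 𝓘(ℝ, M)]
  [FiniteDimensional ℂ M] [FiniteDimensional ℂ F] [IsManifold 𝓘(ℂ, M) ω X] [T2Space X]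

set_option maxHeartbeats 1000000 in
/-- The kernel of a parallel endomorphism is a smooth subbundle. -/
lemma isSmoothSubbundle_ker {D : CovariantDerivative 𝓘(ℝ, M) F V}
    (hD : D.ContMDiffCovariantDerivative ∞) {f : Π x : X, Module.End ℂ (V x)}
    (hf : IsSmoothEndomorphism M F f)
    (hfD : ∀ σ : Π x : X, V x, IsSmoothSection M F σ →
      ∀ (x : X) (u : TangentSpace 𝓘(ℝ, M) x), D (fun y => f y (σ y)) x u = f x (D σ x u)) :
    IsSmoothSubbundle M F (fun x => LinearMap.ker (f x)) := by
  intro x₀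
  have : FiniteDimensional ℝ F := FiniteDimensional.complexToReal F
  have : IsManifold 𝓘(ℝ, M) ∞ X := IsManifold.of_le (n := ω) le_top
  obtain ⟨A, C, hA⟩ := exists_connectionForm hD x₀ hf hfD
  set e := trivializationAt F V x₀
  set K := realEndInTrivialization e f with hK
  have hx₀ : x₀ ∈ e.baseSet := FiberBundle.mem_baseSet_trivializationAt F V x₀
  have hKs := contMDiffOn_realEndInTrivialization (M := M) e hf
  obtain ⟨U, hUA, hU, hxU⟩ := eventually_nhds_iff.1 (hA.and (e.open_baseSet.mem_nhds hx₀))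
  let φ := chartAt M x₀
  let Ω := φ.target ∩ φ.symm ⁻¹' U
  have hΩ : IsOpen Ω := φ.symm.isOpen_inter_preimage hU
  have hφx : φ x₀ ∈ Ω := ⟨mem_chart_target M x₀, by
    rw [mem_preimage, φ.left_inv (mem_chart_source M x₀)]; exact hxU⟩
  have hKφ : ContMDiffOn 𝓘(ℝ, M) 𝓘(ℝ, F →L[ℝ] F) ∞ (K ∘ φ.symm) Ω :=
    hKs.comp ((contMDiffOn_chart_symm (I := 𝓘(ℝ, M))).mono inter_subset_left)
      fun z hz => (hUA _ hz.2).2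
  -- A real-linear inverse suffices: the frame obtained below lies in the kernels, which are complex
  -- subspaces.
  obtain ⟨g₀, hg₀⟩ := LinearMap.exists_generalized_inverse (K x₀ : F →ₗ[ℝ] F)
  have hleft : φ.symm (φ x₀) = x₀ := φ.left_inv (mem_chart_source M x₀)
  obtain ⟨G, N, hN, hxN, hNΩ, hG, hKGK⟩ := exists_smooth_generalized_inverse
    (K := K ∘ φ.symm) (A := fun z w => A (φ.symm z) w) (C := C) hΩ hφx
    (contMDiffOn_iff_contDiffOn.1 hKφ) (fun z hz w => ((hUA _ hz.2).1 w).1)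
    (fun z hz w => by
      have h := ((hUA _ hz.2).1 w).2
      have hz' : φ.symm z ∈ φ.source := φ.map_target hz.1
      rw [TangentBundle.symmL_trivializationAt hz'] at h
      have hd1 : MDifferentiableAt 𝓘(ℝ, M) 𝓘(ℝ, F →L[ℝ] F) K (φ.symm z) :=
        (hKs.contMDiffAt (e.open_baseSet.mem_nhds (hUA _ hz.2).2)).mdifferentiableAt (by simp)
      have hd2 : MDifferentiableAt 𝓘(ℝ, M) 𝓘(ℝ, M) φ.symm z :=
        ((contMDiffOn_chart_symm (I := 𝓘(ℝ, M)) (n := ∞)).contMDiffAt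
          (φ.open_target.mem_nhds hz.1)).mdifferentiableAt (by simp)
      rw [← mfderiv_eq_fderiv, mfderiv_comp z hd1 hd2]
      simp only [extChartAt_coe, extChartAt_coe_symm, modelWithCornersSelf_coe, range_id,
        modelWithCornersSelf_coe_symm, Function.comp_id, mfderivWithin_univ,
        Function.comp_apply, id] at h
      -- The tangent trivialization differentiates `φ.symm` at `φ (φ.symm z)`. This point equals
      -- `z`, but tangent spaces depend on it, so the derivatives are compared as vectors of `M`.
      have hright : ∀ z', z' = z → (mfderiv 𝓘(ℝ, M) 𝓘(ℝ, M) φ.symm z w : M)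
          = (mfderiv 𝓘(ℝ, M) 𝓘(ℝ, M) φ.symm z' w : M) := by
        rintro _ rfl
        rfl
      exact (congrArg (mfderiv 𝓘(ℝ, M) 𝓘(ℝ, F →L[ℝ] F) K (φ.symm z) : M → F →L[ℝ] F)
        (hright (φ (φ.symm z)) (φ.right_inv hz.1))).trans h)
    (g₀ := LinearMap.toContinuousLinearMap g₀) (by
      rw [Function.comp_apply, hleft]
      ext v
      exact LinearMap.congr_fun hg₀ v)
  -- The projection onto `ker K`: `K P = K - K G K = 0`, and `P` fixes every vector killed by `K`.
  let P : X → F →L[ℝ] F := fun x => 1 - G (φ x) * K x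
  let N' := φ.source ∩ φ ⁻¹' N
  have hN' : IsOpen N' := φ.isOpen_inter_preimage hN
  have hxN' : x₀ ∈ N' := ⟨mem_chart_source M x₀, hxN⟩
  have hN'e : N' ⊆ e.baseSet := fun x hx => by
    have := (hUA _ (hNΩ hx.2).2).2
    rwa [φ.left_inv hx.1] at this
  have hP : ContMDiffOn 𝓘(ℝ, M) 𝓘(ℝ, F →L[ℝ] F) ∞ P N' := by
    have hGφ : ContMDiffOn 𝓘(ℝ, M) 𝓘(ℝ, F →L[ℝ] F) ∞ (fun x => G (φ x)) N' :=
      (contMDiffOn_iff_contDiffOn.2 hG).comp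
        ((contMDiffOn_chart (I := 𝓘(ℝ, M))).mono inter_subset_left) fun x hx => hx.2
    exact contMDiffOn_const.sub (hGφ.clm_comp (hKs.mono hN'e))
  have hKP : ∀ x ∈ N', ∀ w, endInTrivialization e f x (P x w) = 0 := fun x hx w => by
    have h := hKGK _ hx.2
    rw [Function.comp_apply, φ.left_inv hx.1] at h
    have h' : K x * P x = 0 := by rw [mul_sub, ← mul_assoc, h, mul_one, sub_self]
    exact DFunLike.congr_fun h' w
  have hPK : ∀ x, ∀ w, endInTrivialization e f x w = 0 → P x w = w := fun x w hw => by
    have hw' : K x w = 0 := hw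
    change w - G (φ x) (K x w) = w
    rw [hw', map_zero, sub_zero]
  obtain ⟨k, v, hv⟩ := eventually_span_projection_eq_ker
    (hP.continuousOn.continuousAt (hN'.mem_nhds hxN'))
    (Filter.eventually_of_mem (hN'.mem_nhds hxN') hKP) (Filter.Eventually.of_forall hPK)
  obtain ⟨W, hWv, hW, hxW⟩ := eventually_nhds_iff.1 hv
  refine ⟨W ∩ N', hW.inter hN', ⟨hxW, hxN'⟩, k, fun i x => e.symm x (P x (v i)), fun i => ?_,
    fun x hx => linearIndependent_and_span_symm_eq_ker e f (hN'e hx.2) (hWv x hx.1).1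
      (hWv x hx.1).2⟩
  exact contMDiffOn_trivialization_symm e (hW.inter hN') (inter_subset_right.trans hN'e)
    ((hP.mono inter_subset_right).clm_apply contMDiffOn_const)

/-- The kernel of a parallel endomorphism is a `D`-subbundle. -/
lemma isDSubbundle_ker {D : CovariantDerivative 𝓘(ℝ, M) F V}
    (hD : D.ContMDiffCovariantDerivative ∞) {f : Π x : X, Module.End ℂ (V x)}
    (hf : IsSmoothEndomorphism M F f)
    (hfD : ∀ σ : Π x : X, V x, IsSmoothSection M F σ →
      ∀ (x : X) (u : TangentSpace 𝓘(ℝ, M) x), D (fun y => f y (σ y)) x u = f x (D σ x u)) :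
    IsDSubbundle D (fun x => LinearMap.ker (f x)) where
  subbundle := isSmoothSubbundle_ker hD hf hfD
  invariant σ hσ hS x u := by
    have h0 : (fun y => f y (σ y)) = 0 := funext hS
    rw [LinearMap.mem_ker, ← hfD σ hσ x u, h0, D.zero]
    rfl

end ParallelSubbundle

/-! ### Schur's lemma for simple bundles. -/

theorem proposition2p5
    {M : Type*} [NormedAddCommGroup M] [NormedSpace ℂ M] [FiniteDimensional ℂ M]
    {X : Type*} [TopologicalSpace X] [ChartedSpace M X] [IsManifold 𝓘(ℂ, M) ω X]
    [T2Space X] [SigmaCompactSpace X] [ConnectedSpace X]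
    (g : KahlerMetric M X)
    {F : Type*} [NormedAddCommGroup F] [NormedSpace ℂ F] [FiniteDimensional ℂ F]
    {V : X → Type*} [TopologicalSpace (TotalSpace F V)] [∀ x, TopologicalSpace (V x)]
    [∀ x, AddCommGroup (V x)] [∀ x, Module ℂ (V x)]
    [∀ x, IsTopologicalAddGroup (V x)] [∀ x, ContinuousSMul ℂ (V x)]
    [FiberBundle F V] [VectorBundle ℂ F V] [ContMDiffVectorBundle ∞ F V 𝓘(ℝ, M)]
    (D : CovariantDerivative 𝓘(ℝ, M) F V) (hD : IsNHYM g D) (hsimple : IsSimpleBundle D) :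
    (∀ f ∈ parallelEnd D hD.connection, ∃ c : ℂ, ∀ x, f x = c • LinearMap.id) ∧
      Nonempty (parallelEnd D hD.connection ≃ₐ[ℂ] ℂ) := by
  obtain ⟨x₀, hx₀⟩ : ∃ x₀, Nontrivial (V x₀) := by
    by_contra! h
    refine hsimple.nonzero (funext fun x => ?_)
    have := h x
    exact Subsingleton.elim _ _
  have hscalar : ∀ f ∈ parallelEnd D hD.connection, ∃ c : ℂ, f = algebraMap ℂ _ c := by
    intro f hf
    have : FiniteDimensional ℂ (V x₀) :=
      ((trivializationAt F V x₀).linearEquivAt ℂ x₀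
        (FiberBundle.mem_baseSet_trivializationAt F V x₀)).symm.finiteDimensional
    -- An eigenvalue at the single point `x₀` is enough: simplicity, applied to the kernel of `f -
    -- c`, spreads it over `X`.
    obtain ⟨c, hc⟩ := Module.End.exists_eigenvalue (f x₀)
    obtain ⟨v, hv⟩ := hc.exists_hasEigenvector
    refine ⟨c, ?_⟩
    obtain ⟨hh, hhD⟩ := sub_mem hf ((parallelEnd D hD.connection).algebraMap_mem c)
    have hker := isDSubbundle_ker hD.connection.smooth hh hhD
    rcases hsimple.simple _ hker with h | h
    · refine absurd ?_ hv.2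
      have hv' : v ∈ LinearMap.ker ((f - algebraMap ℂ (Π x : X, Module.End ℂ (V x)) c) x₀) := by
        have := hv.apply_eq_smul
        simp [this, Algebra.algebraMap_eq_smul_one]
      rw [show LinearMap.ker ((f - algebraMap ℂ (Π x : X, Module.End ℂ (V x)) c) x₀) = ⊥ from
        congrFun h x₀] at hv'
      exact hv'
    · exact sub_eq_zero.1 (funext fun x => LinearMap.ker_eq_top.1 (congrFun h x))
  -- The structure map from `ℂ` is injective because the fibre at `x₀` is nonzero, and surjective by
  -- `hscalar`.
  refine ⟨fun f hf => ?_, ⟨(AlgEquiv.ofBijective (Algebra.ofId ℂ _) ⟨?_, ?_⟩).symm⟩⟩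
  · obtain ⟨c, rfl⟩ := hscalar f hf
    exact ⟨c, fun x => Algebra.algebraMap_eq_smul_one c⟩
  · intro c d hcd
    have h : algebraMap ℂ (Module.End ℂ (V x₀)) c = algebraMap ℂ (Module.End ℂ (V x₀)) d :=
      congrFun (congrArg Subtype.val hcd) x₀
    exact (algebraMap ℂ (Module.End ℂ (V x₀))).injective h
  · rintro ⟨f, hf⟩
    obtain ⟨c, rfl⟩ := hscalar f hf
    exact ⟨c, rfl⟩
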